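/- Let $K_n$ be the complete graph on $n$ vertices, let $\beta_n\ge 0$ for each $n$, and let $\mathbf U=(U_e)_{e\in E(K_n)}$ be i.i.d. random variables uniform on $[0,1]$. Let $\mathsf{MST}_n$ be the spanning tree $T$ of $K_n$ minimizing $\sum_{e\in T}U_e$ (almost surely unique). Let $\mathsf{WST}_n^{\beta_n}$ be a random spanning tree of $K_n$ whose conditional law given $\mathbf U$ is $$\mathbb P\left(\mathsf{WST}_n^{\beta_n}=T\mid \mathbf U\right)=\frac{\exp\left(-\beta_n\sum_{e\in T}U_e\right)}{\sum_{T'}\exp\left(-\beta_n\sum_{e\in T'}U_e\right)}$$ for every spanning tree $T$ of $K_n$, where $T'$ runs over all spanning trees of $K_n$. Both trees are built from the same labels $\mathbf U$, and $\mathbb P$ denotes the resulting joint law. Then the following holds. a) If $n^2\log n=o(\beta_n)$ as $n\to\infty$, then $\lim_{n\to\infty}\mathbb P\left(\mathsf{WST}_n^{\beta_n}=\mathsf{MST}_n\right)=1$. b) If $\beta_n=o(n^2)$ as $n\to\infty$, then $\lim_{n\to\infty}\mathbb P\left(\mathsf{WST}_n^{\beta_n}\ne\mathsf{MST}_n\right)=1$.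 -/

import Mathlib

open MeasureTheory ProbabilityTheory Filter Asymptotics
open scoped ENNReal Topology

noncomputable section

namespace RandomSpanningTree

variable {V : Type*} [Fintype V]

open Classical in
/-- The spanning trees of `G`: subgraphs of `G` on the whole vertex set that are trees. -/
def spanningTrees (G : SimpleGraph V) : Finset (SimpleGraph V) :=
  {T | T ≤ G ∧ T.IsTree}

open Classical in
/-- The i.i.d. `Unif[0,1]` law of the family of labels `(U_e)`, `e` an edge of `G`. -/
def labelLaw (G : SimpleGraph V) : Measure (G.edgeSet → ℝ) :=
  Measure.pi fun _ => volume.restrict (Set.Icc (0 : ℝ) 1)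

open Classical in
/-- The sum of the labels over the edges of `T`. -/
def totalLabel (G : SimpleGraph V) (u : G.edgeSet → ℝ) (T : SimpleGraph V) : ℝ :=
  ∑ e : G.edgeSet with e.1 ∈ T.edgeSet, u e

/-- The minimum spanning tree of `G` for the labels `u`: the spanning tree with the smallest sum
of labels. If several spanning trees attain the minimum (an event of probability zero for
i.i.d. uniform labels), an arbitrary one of them is selected. -/
def MST (G : SimpleGraph V) (u : G.edgeSet → ℝ) : SimpleGraph V :=
  Classical.epsilon fun T =>
    T ∈ spanningTrees G ∧ ∀ T' ∈ spanningTrees G, totalLabel G u T ≤ totalLabel G u T'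

/-- The normalizing constant `Z_β(G | u)`. -/
def partitionFunction (G : SimpleGraph V) (β : ℝ) (u : G.edgeSet → ℝ) : ℝ :=
  ∑ T ∈ spanningTrees G, Real.exp (-β * totalLabel G u T)

/-- The conditional probability of the spanning tree `T` given the labels `u`. -/
def treeProb (G : SimpleGraph V) (β : ℝ) (u : G.edgeSet → ℝ) (T : SimpleGraph V) : ℝ :=
  Real.exp (-β * totalLabel G u T) / partitionFunction G β u

lemma measurable_totalLabel (G : SimpleGraph V) (T : SimpleGraph V) :
    Measurable fun u => totalLabel G u T := by
  unfold totalLabel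
  fun_prop

lemma measurable_treeProb (G : SimpleGraph V) (β : ℝ) (T : SimpleGraph V) :
    Measurable fun u => treeProb G β u T := by
  have h := measurable_totalLabel G
  unfold treeProb partitionFunction
  fun_prop

/-- The conditional law of the weighted spanning tree given the labels: the spanning tree `T` has
probability `treeProb G β u T` when the labels are `u`. -/
def wstKernel (G : SimpleGraph V) (β : ℝ) : Kernel (G.edgeSet → ℝ) (SimpleGraph V) where
  toFun u := ∑ T ∈ spanningTrees G, ENNReal.ofReal (treeProb G β u T) • Measure.dirac T
  measurable' := by
    refine Measure.measurable_of_measurable_coe _ fun s _ => ?_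
    simp only [Measure.coe_finsetSum, Finset.sum_apply, Measure.smul_apply, smul_eq_mul]
    have h := measurable_treeProb G β
    fun_prop

/-- For a connected graph, the conditional law of the weighted spanning tree is a probability
measure for all labels. -/
lemma isMarkovKernel_wstKernel {G : SimpleGraph V} (hG : G.Connected) (β : ℝ) :
    IsMarkovKernel (wstKernel G β) := by
  classical
  refine ⟨fun u => ⟨?_⟩⟩
  obtain ⟨T, hT, hT'⟩ := hG.exists_isTree_le
  have hZ : 0 < partitionFunction G β u :=
    Finset.sum_pos (fun _ _ => Real.exp_pos _) ⟨T, by simp [spanningTrees, hT, hT']⟩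
  change (∑ T ∈ spanningTrees G, ENNReal.ofReal (treeProb G β u T) • Measure.dirac T :
    Measure (SimpleGraph V)) Set.univ = 1
  simp only [Measure.coe_finsetSum, Finset.sum_apply, Measure.smul_apply, smul_eq_mul,
    measure_univ, mul_one]
  have hnn : ∀ T ∈ spanningTrees G, 0 ≤ treeProb G β u T :=
    fun T _ => div_nonneg (Real.exp_pos _).le hZ.le
  rw [← ENNReal.ofReal_sum_of_nonneg hnn]
  simp only [treeProb]
  rw [← Finset.sum_div]
  change ENNReal.ofReal (partitionFunction G β u / _) = 1
  rw [div_self hZ.ne', ENNReal.ofReal_one]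

instance isProbabilityMeasure_labelLaw (G : SimpleGraph V) :
    IsProbabilityMeasure (labelLaw G) := by
  have : IsProbabilityMeasure (volume.restrict (Set.Icc (0 : ℝ) 1)) := ⟨by simp⟩
  unfold labelLaw
  infer_instance

/-- The coupling of `WST^β(G)` and `MST(G)` through the same labels, as the joint law of the pair
`(U, WST^β(G))`: the labels `U` are i.i.d. `Unif[0,1]`, and given `U` the tree has the law of the
weighted spanning tree. The minimum spanning tree is the function `MST G U` of the labels. -/
def coupling (G : SimpleGraph V) (β : ℝ) : Measure ((G.edgeSet → ℝ) × SimpleGraph V) :=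
  labelLaw G ⊗ₘ wstKernel G β

lemma isProbabilityMeasure_coupling {G : SimpleGraph V} (hG : G.Connected) (β : ℝ) :
    IsProbabilityMeasure (coupling G β) := by
  have := isMarkovKernel_wstKernel hG β
  unfold coupling
  infer_instance

end RandomSpanningTree

end

/-! Exchanging one edge of a tree is what compares the two trees. For an edge `e` outside a spanning
tree `T`, the bottleneck of `e` is the largest label on the path of `T` joining the ends of `e`;
`T` is the minimum spanning tree exactly when every outer edge lies above its bottleneck.

If `β` is large, every outer edge of the minimum spanning tree lies above its bottleneck by more
than `δ`, except with probability at most `m δ`, where `m` is the number of edges. Outside this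
event each other tree can be obtained by a swap from a tree whose weight is larger by a factor
`exp (β δ)`, and there are at most `m ^ 2` swaps, so the other trees carry conditional probability
at most `m ^ 2 * exp (-β δ)`.

If `β` is small, the swaps that replace the bottleneck of an outer edge of `T` produce different
trees, of total weight `S` relative to `T`, so `T` has conditional probability at most
`1 / (1 + S)`. Given that `T` is minimal and given the labels on `T`, the labels outside `T` are
independent and uniform above their bottlenecks. This makes `S` of order at least `k / (1 + |β|)`
with high probability, where `k` is the number of edges outside `T`.
-/

namespace RandomSpanningTree

section ProbabilityMeasure

lemma tendsto_measure_compl_one {ι : Type*} {l : Filter ι} {Ω : ι → Type*}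
    [∀ i, MeasurableSpace (Ω i)] {μ : ∀ i, Measure (Ω i)}
    (hμ : ∀ᶠ i in l, IsProbabilityMeasure (μ i)) {s : ∀ i, Set (Ω i)}
    (hs : ∀ i, MeasurableSet (s i)) (h : Tendsto (fun i => μ i (s i)) l (𝓝 0)) :
    Tendsto (fun i => μ i (s i)ᶜ) l (𝓝 1) := by
  have hsub := ENNReal.Tendsto.sub (tendsto_const_nhds (x := 1)) h (.inl ENNReal.one_ne_top)
  rw [tsub_zero] at hsub
  refine hsub.congr' ?_
  filter_upwards [hμ] with i hi
  exact (prob_compl_eq_one_sub (hs i)).symm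

lemma measure_pi_le_of_update {ι : Type*} [Fintype ι] [DecidableEq ι] {X : ι → Type*}
    [∀ i, MeasurableSpace (X i)] (μ : ∀ i, Measure (X i)) [∀ i, IsProbabilityMeasure (μ i)]
    {s : Set (∀ i, X i)} (hs : MeasurableSet s) (i : ι) (c : ℝ≥0∞)
    (h : ∀ u, μ i (Function.update u i ⁻¹' s) ≤ c) : Measure.pi μ s ≤ c := by
  have hmarginal : ∫⋯∫⁻_{i}, s.indicator 1 ∂μ ≤ ∫⋯∫⁻_{i}, (fun _ => c) ∂μ := by
    intro u
    rw [lmarginal_singleton, lmarginal_singleton, lintegral_const, measure_univ, mul_one]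
    calc ∫⁻ x, s.indicator 1 (Function.update u i x) ∂μ i
        = μ i (Function.update u i ⁻¹' s) := lintegral_indicator_one (measurable_update u hs)
      _ ≤ c := h u
  simpa [lintegral_indicator_one hs] using lintegral_le_of_lmarginal_le (μ := μ) {i}
    (measurable_one.indicator hs) measurable_const hmarginal

variable {ι : Type*} {X : ι → Type*} [∀ i, MeasurableSpace (X i)]
  {μ : ∀ i, Measure (X i)} [∀ i, IsProbabilityMeasure (μ i)] {N : Finset ι}
  {f g : ∀ i, (∀ j, X j) → X i → ℝ≥0∞}

lemma lmarginal_prod_eq_prod_lintegral [DecidableEq ι]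
    (hf : ∀ i ∈ N, Measurable fun u => f i u (u i))
    (hfN : ∀ i ∈ N, DependsOn (f i) (↑N)ᶜ) (u : ∀ j, X j) :
    (∫⋯∫⁻_N, fun u => ∏ i ∈ N, f i u (u i) ∂μ) u = ∏ i ∈ N, ∫⁻ x, f i u x ∂μ i := by
  have hsection (i : N) : Measurable (f i u) := by
    have hi (x : X i) : f i (Function.update u i x) = f i u := hfN i i.2 fun j hj =>
      Function.update_of_ne (ne_of_mem_of_not_mem i.2 hj).symm _ _
    simpa [Function.comp_def, hi] using (hf i i.2).comp (measurable_update u (a := (i : ι)))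
  have hupdate (y : ∀ i : N, X i) (i : N) : f i (Function.updateFinset u N y) = f i u :=
    hfN i i.2 fun j hj => dif_neg hj
  calc (∫⋯∫⁻_N, fun u => ∏ i ∈ N, f i u (u i) ∂μ) u
      = ∫⁻ y, ∏ i : N, f i u (y i) ∂Measure.pi fun i : N => μ i := by
        simp only [lmarginal, ← Finset.prod_coe_sort N, hupdate, Function.updateFinset,
          Finset.coe_mem, dif_pos]
    _ = ∏ i : N, ∫⁻ y, f i u (y i) ∂Measure.pi fun i : N => μ i :=
        lintegral_prod_eq_prod_lintegral_of_indepFun Finset.univ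
          (fun (i : N) (y : ∀ i : N, X i) => f i u (y i))
          (iIndepFun_pi fun i : N => (hsection i).aemeasurable)
          fun i => (hsection i).comp (measurable_pi_apply i)
    _ = ∏ i : N, ∫⁻ x, f i u x ∂μ i :=
        Finset.prod_congr rfl fun i _ =>
          (measurePreserving_eval (fun i : N => μ i) i).lintegral_comp (hsection i)
    _ = ∏ i ∈ N, ∫⁻ x, f i u x ∂μ i := Finset.prod_coe_sort N fun i => ∫⁻ x, f i u x ∂μ i

lemma lintegral_prod_le_pow_mul [Fintype ι] (hf : ∀ i ∈ N, Measurable fun u => f i u (u i))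
    (hg : ∀ i ∈ N, Measurable fun u => g i u (u i)) (hfN : ∀ i ∈ N, DependsOn (f i) (↑N)ᶜ)
    (hgN : ∀ i ∈ N, DependsOn (g i) (↑N)ᶜ) {c : ℝ≥0∞}
    (h : ∀ i ∈ N, ∀ u, ∫⁻ x, f i u x ∂μ i ≤ c * ∫⁻ x, g i u x ∂μ i) :
    ∫⁻ u, ∏ i ∈ N, f i u (u i) ∂Measure.pi μ ≤
      c ^ N.card * ∫⁻ u, ∏ i ∈ N, g i u (u i) ∂Measure.pi μ := by
  classical
  have hgm := Finset.measurable_fun_prod N hg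
  rw [← lintegral_const_mul _ hgm]
  refine lintegral_le_of_lmarginal_le N (Finset.measurable_fun_prod N hf) (hgm.const_mul _)
    fun u => ?_
  calc (∫⋯∫⁻_N, fun u => ∏ i ∈ N, f i u (u i) ∂μ) u
      = ∏ i ∈ N, ∫⁻ x, f i u x ∂μ i := lmarginal_prod_eq_prod_lintegral hf hfN u
    _ ≤ ∏ i ∈ N, c * ∫⁻ x, g i u x ∂μ i := Finset.prod_le_prod' fun i hi => h i hi u
    _ = c ^ N.card * (∫⋯∫⁻_N, fun u => ∏ i ∈ N, g i u (u i) ∂μ) u := by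
        rw [Finset.prod_mul_distrib, Finset.prod_const, lmarginal_prod_eq_prod_lintegral hg hgN]
    _ = (∫⋯∫⁻_N, fun u => c ^ N.card * ∏ i ∈ N, g i u (u i) ∂μ) u :=
        (lintegral_const_mul _ (hgm.comp measurable_updateFinset)).symm

end ProbabilityMeasure

section RealEstimates

lemma exp_neg_exp_neg_le {x : ℝ} (hx : x ≤ 1) : Real.exp (-Real.exp (-x)) ≤ 3 / 4 := by
  have hthird : 1 / 3 ≤ Real.exp (-x) := calc
    1 / 3 ≤ Real.exp (-1) := by linarith [Real.exp_neg_one_gt_d9]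
    _ ≤ Real.exp (-x) := Real.exp_le_exp.2 (neg_le_neg hx)
  rw [Real.exp_neg, inv_le_comm₀ (Real.exp_pos _) (by norm_num)]
  linarith [Real.add_one_le_exp (Real.exp (-x))]

lemma setLIntegral_Ioc_le_ofReal {f : ℝ → ℝ≥0∞} {a b c p q : ℝ} (hac : a ≤ c) (hcb : c ≤ b)
    (hp : 0 ≤ p) (hq : 0 ≤ q) (hleft : ∀ x ∈ Set.Ioc a c, f x ≤ ENNReal.ofReal p)
    (hright : ∀ x ∈ Set.Ioc c b, f x ≤ ENNReal.ofReal q) :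
    ∫⁻ x in Set.Ioc a b, f x ≤ ENNReal.ofReal (p * (c - a) + q * (b - c)) := calc
  ∫⁻ x in Set.Ioc a b, f x ≤ (∫⁻ x in Set.Ioc a c, f x) + ∫⁻ x in Set.Ioc c b, f x := by
    rw [← Set.Ioc_union_Ioc_eq_Ioc hac hcb]
    exact lintegral_union_le _ _ _
  _ ≤ (∫⁻ _ in Set.Ioc a c, ENNReal.ofReal p) + ∫⁻ _ in Set.Ioc c b, ENNReal.ofReal q :=
    add_le_add (setLIntegral_mono measurable_const hleft)
      (setLIntegral_mono measurable_const hright)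
  _ = ENNReal.ofReal (p * (c - a) + q * (b - c)) := by
    rw [setLIntegral_const, setLIntegral_const, Real.volume_Ioc, Real.volume_Ioc,
      ← ENNReal.ofReal_mul hp, ← ENNReal.ofReal_mul hq,
      ← ENNReal.ofReal_add (mul_nonneg hp (sub_nonneg.2 hac)) (mul_nonneg hq (sub_nonneg.2 hcb))]

/-- On the left part of the interval, of length `(b - a) / (1 + |β|)`, the integrand is at most
`3 / 4`. -/
lemma setLIntegral_Ioc_exp_neg_exp_le (β : ℝ) {a b : ℝ} (hab : b ≤ a + 1) :
    ∫⁻ x in Set.Ioc a b, ENNReal.ofReal (Real.exp (-Real.exp (-(β * (x - a))))) ≤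
      ENNReal.ofReal (Real.exp (-(1 / (4 * (1 + |β|))))) * volume (Set.Ioc a b) := by
  rcases le_total b a with h | h
  · simp [Set.Ioc_eq_empty_of_le h]
  have hpos : 0 < 1 + |β| := by positivity
  have hlen : 0 ≤ b - a := sub_nonneg.2 h
  set d := (b - a) / (1 + |β|) with hd
  have hd0 : 0 ≤ d := div_nonneg hlen hpos.le
  have hdb : d ≤ b - a := div_le_self hlen (le_add_of_nonneg_right (abs_nonneg β))
  have hβd : |β| * d ≤ 1 := by
    rw [hd, ← mul_div_assoc, div_le_one hpos]
    nlinarith [abs_nonneg β]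
  calc ∫⁻ x in Set.Ioc a b, ENNReal.ofReal (Real.exp (-Real.exp (-(β * (x - a)))))
      ≤ ENNReal.ofReal (3 / 4 * (a + d - a) + 1 * (b - (a + d))) := by
        refine setLIntegral_Ioc_le_ofReal (le_add_of_nonneg_right hd0) (by linarith)
          (by norm_num) zero_le_one (fun x hx => ?_) fun x _ => ?_
        · refine ENNReal.ofReal_le_ofReal (exp_neg_exp_neg_le (le_trans ?_ hβd))
          exact mul_le_mul (le_abs_self β) (by linarith [hx.2]) (sub_nonneg.2 hx.1.le)
            (abs_nonneg β)
        · exact ENNReal.ofReal_le_ofReal <| Real.exp_le_one_iff.2 <|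
            neg_nonpos.2 (Real.exp_pos _).le
    _ = ENNReal.ofReal ((1 - 1 / (4 * (1 + |β|))) * (b - a)) := by
        rw [hd]
        congr 1
        field_simp
        ring
    _ ≤ ENNReal.ofReal (Real.exp (-(1 / (4 * (1 + |β|)))) * (b - a)) :=
        ENNReal.ofReal_le_ofReal <| mul_le_mul_of_nonneg_right (Real.one_sub_le_exp_neg _) hlen
    _ = ENNReal.ofReal (Real.exp (-(1 / (4 * (1 + |β|))))) * volume (Set.Ioc a b) := by
        rw [Real.volume_Ioc, ENNReal.ofReal_mul (Real.exp_pos _).le]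

lemma one_div_one_add_le {A S : ℝ} (hA : 0 ≤ A) (hS : 0 ≤ S) :
    1 / (1 + S) ≤ 1 / (1 + A) + Real.exp A * Real.exp (-S) := by
  rcases le_total A S with h | h
  · exact (one_div_le_one_div_of_le (by linarith) (by linarith)).trans
      (le_add_of_nonneg_right (by positivity))
  · have hone : 1 / (1 + S) ≤ 1 := (div_le_one (by linarith)).2 (by linarith)
    have hexp : 1 ≤ Real.exp A * Real.exp (-S) := by
      rw [← Real.exp_add]
      exact Real.one_le_exp (by linarith)
    exact (hone.trans hexp).trans (le_add_of_nonneg_left (by positivity))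

end RealEstimates

section Exchange

variable {V : Type*} {T T' : SimpleGraph V}

/-- The graph obtained from `T` by deleting the edge `f` and adding the edge `e`: the elementary
exchange between spanning trees. -/
def swapEdge (T : SimpleGraph V) (f e : Sym2 V) : SimpleGraph V :=
  T.deleteEdges {f} ⊔ SimpleGraph.fromEdgeSet {e}

lemma edgeSet_swapEdge (T : SimpleGraph V) (f : Sym2 V) {e : Sym2 V} (he : ¬ e.IsDiag) :
    (swapEdge T f e).edgeSet = insert e (T.edgeSet \ {f}) := by
  have hdiag : {e} \ Sym2.diagSet = ({e} : Set (Sym2 V)) := by simpa using he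
  rw [swapEdge, SimpleGraph.edgeSet_sup, SimpleGraph.edgeSet_deleteEdges,
    SimpleGraph.edgeSet_fromEdgeSet, hdiag, Set.union_singleton]

lemma mem_edgeSet_swapEdge (T : SimpleGraph V) (f : Sym2 V) {e : Sym2 V} (he : ¬ e.IsDiag) :
    e ∈ (swapEdge T f e).edgeSet := by
  rw [edgeSet_swapEdge _ _ he]
  exact Set.mem_insert _ _

lemma swapEdge_swapEdge {f e : Sym2 V} (hf : f ∈ T.edgeSet) (he : e ∉ T.edgeSet)
    (he' : ¬ e.IsDiag) : swapEdge (swapEdge T f e) e f = T := by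
  rw [← SimpleGraph.edgeSet_inj, edgeSet_swapEdge _ _ (T.not_isDiag_of_mem_edgeSet hf),
    edgeSet_swapEdge _ _ he', Set.insert_sdiff_self_of_notMem fun h => he h.1,
    Set.insert_sdiff_singleton, Set.insert_eq_of_mem hf]

lemma isTree_of_isAcyclic_of_card [Finite V] [Nonempty V] (hT : T.IsAcyclic)
    (hcard : Nat.card T.edgeSet + 1 = Nat.card V) : T.IsTree := by
  obtain ⟨F, hTF, -, hF⟩ :=
    SimpleGraph.connected_top.exists_isTree_le_of_le_of_isAcyclic (le_top : T ≤ ⊤) hT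
  have hFcard := (SimpleGraph.isTree_iff_connected_and_card.1 hF).2
  have hedge : T.edgeSet = F.edgeSet :=
    Set.eq_of_subset_of_ncard_le (SimpleGraph.edgeSet_mono hTF)
      (by simp only [← Nat.card_coe_set_eq]; omega) (Set.toFinite _)
  rwa [SimpleGraph.edgeSet_inj.1 hedge]

lemma isTree_swapEdge [Finite V] (hT : T.IsTree) {f : Sym2 V} (hf : f ∈ T.edgeSet) {x y : V}
    (he : s(x, y) ∉ T.edgeSet) (hxy : ¬ (T.deleteEdges {f}).Reachable x y) :
    (swapEdge T f s(x, y)).IsTree := by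
  have := hT.connected.nonempty
  have hdiag : ¬ s(x, y).IsDiag := fun h => hxy (by rw [Sym2.mk_isDiag_iff.1 h])
  refine isTree_of_isAcyclic_of_card
    ((hT.isAcyclic.anti (T.deleteEdges_le _)).sup_edge_of_not_reachable hxy) ?_
  rw [edgeSet_swapEdge _ _ hdiag, Nat.card_coe_set_eq, Set.ncard_insert_of_notMem fun h => he h.1,
    Set.ncard_sdiff_singleton_add_one hf, ← Nat.card_coe_set_eq]
  exact (SimpleGraph.isTree_iff_connected_and_card.1 hT).2

lemma not_reachable_deleteEdges_of_mem_edges (hT : T.IsAcyclic) {x y : V} {p : T.Walk x y}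
    (hp : p.IsPath) {f : Sym2 V} (hf : f ∈ p.edges) : ¬ (T.deleteEdges {f}).Reachable x y := by
  intro h
  obtain ⟨q, hq⟩ := h.exists_isPath
  have hpq : p = q.mapLe (T.deleteEdges_le {f}) := congrArg Subtype.val <|
    (hT.subsingleton_path x y).elim ⟨p, hp⟩ ⟨_, hq.mapLe (T.deleteEdges_le {f})⟩
  rw [hpq, SimpleGraph.Walk.edges_mapLe_eq_edges] at hf
  simpa using q.edges_subset_edgeSet hf

lemma exists_isTree_swapEdge [Finite V] (hT : T.IsTree) (hT' : T'.IsTree) {e : Sym2 V}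
    (he : e ∈ T.edgeSet) (he' : e ∉ T'.edgeSet) :
    ∃ f ∈ T'.edgeSet, f ∉ T.edgeSet ∧ (swapEdge T e f).IsTree ∧ (swapEdge T' f e).IsTree := by
  induction e using Sym2.ind with | _ x y
  have hsep : ¬ (T.deleteEdges {s(x, y)}).Reachable x y :=
    SimpleGraph.isBridge_iff.1 (SimpleGraph.isAcyclic_iff_forall_isBridge.1 hT.isAcyclic he)
  -- `f` is an edge where the path of `T'` between the ends of `e` leaves a component of `T - e`.
  obtain ⟨p, hp⟩ := (hT'.connected.preconnected x y).exists_isPath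
  obtain ⟨d, hd, hfst, hsnd⟩ := p.exists_boundary_dart
    {v | (T.deleteEdges {s(x, y)}).Reachable x v} (SimpleGraph.Reachable.refl _) hsep
  have hdsep : ¬ (T.deleteEdges {s(x, y)}).Reachable d.fst d.snd := fun h => hsnd (hfst.trans h)
  have hdT : d.edge ∉ T.edgeSet := fun h => hdsep <| SimpleGraph.Adj.reachable <|
    SimpleGraph.deleteEdges_adj.2 ⟨h, fun h' => he' (h' ▸ d.edge_mem)⟩
  exact ⟨d.edge, d.edge_mem, hdT, isTree_swapEdge hT he hdT hdsep, isTree_swapEdge hT' d.edge_mem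
    he' (not_reachable_deleteEdges_of_mem_edges hT'.isAcyclic hp (List.mem_map_of_mem hd))⟩

lemma exists_mem_edgeSet_of_ne (hT : T.IsTree) (hT' : T'.IsTree) (h : T ≠ T') :
    ∃ e ∈ T.edgeSet, e ∉ T'.edgeSet := by
  by_contra! hsub
  have hle : T ≤ T' := SimpleGraph.edgeSet_subset_edgeSet.1 hsub
  exact h (le_antisymm hle ((SimpleGraph.isTree_iff_minimal_connected.1 hT').2 hT.connected hle))

lemma exists_isTree_swapEdge_of_notMem [Finite V] (hT : T.IsTree) {e : Sym2 V}
    (he : e ∉ T.edgeSet) (he' : ¬ e.IsDiag) : ∃ f ∈ T.edgeSet, (swapEdge T f e).IsTree := by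
  have := hT.connected.nonempty
  induction e using Sym2.ind with | _ x y
  have hedge : (SimpleGraph.edge x y).IsAcyclic := by
    simpa using SimpleGraph.isAcyclic_bot.sup_edge_of_not_reachable (u := x) (v := y)
      (by simpa [SimpleGraph.reachable_bot] using he')
  obtain ⟨F, hF, -, hFtree⟩ :=
    SimpleGraph.connected_top.exists_isTree_le_of_le_of_isAcyclic (le_top : _ ≤ ⊤) hedge
  have heF : s(x, y) ∈ F.edgeSet := SimpleGraph.edgeSet_mono hF (by simpa using he')
  obtain ⟨f, hf, -, -, h⟩ := exists_isTree_swapEdge hFtree hT heF he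
  exact ⟨f, hf, h⟩

end Exchange

section SpanningTrees

variable {V : Type*} [Fintype V] {G T T' : SimpleGraph V}

lemma mem_spanningTrees : T ∈ spanningTrees G ↔ T ≤ G ∧ T.IsTree := by
  simp [spanningTrees]

lemma spanningTrees_nonempty (hG : G.Connected) : (spanningTrees G).Nonempty := by
  obtain ⟨T, hTG, hT⟩ := hG.exists_isTree_le
  exact ⟨T, mem_spanningTrees.2 ⟨hTG, hT⟩⟩

lemma swapEdge_mem_spanningTrees (hT : T ≤ G) {e : G.edgeSet} {f : Sym2 V}
    (h : (swapEdge T f e).IsTree) : swapEdge T f e ∈ spanningTrees G := by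
  refine mem_spanningTrees.2 ⟨?_, h⟩
  rw [← SimpleGraph.edgeSet_subset_edgeSet,
    edgeSet_swapEdge _ _ (G.not_isDiag_of_mem_edgeSet e.2)]
  exact Set.insert_subset e.2 (Set.sdiff_subset.trans (SimpleGraph.edgeSet_mono hT))

lemma exists_isTree_swapEdge_of_ne (hT : T ∈ spanningTrees G) (hT' : T' ∈ spanningTrees G)
    (hne : T ≠ T') : ∃ e f : G.edgeSet, e.1 ∈ T.edgeSet ∧ e.1 ∉ T'.edgeSet ∧ f.1 ∈ T'.edgeSet ∧
      f.1 ∉ T.edgeSet ∧ (swapEdge T e f).IsTree ∧ (swapEdge T' f e).IsTree := by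
  rw [mem_spanningTrees] at hT hT'
  obtain ⟨e, he, he'⟩ := exists_mem_edgeSet_of_ne hT.2 hT'.2 hne
  obtain ⟨f, hf', hf, h, h'⟩ := exists_isTree_swapEdge hT.2 hT'.2 he he'
  exact ⟨⟨e, SimpleGraph.edgeSet_mono hT.1 he⟩, ⟨f, SimpleGraph.edgeSet_mono hT'.1 hf'⟩,
    he, he', hf', hf, h, h'⟩

lemma totalLabel_swapEdge {e f : G.edgeSet} (he : e.1 ∉ T.edgeSet) (hf : f.1 ∈ T.edgeSet)
    (u : G.edgeSet → ℝ) :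
    totalLabel G u (swapEdge T f e) = totalLabel G u T - u f + u e := by
  classical
  have hterm : ∀ a : G.edgeSet, (if a.1 ∈ (swapEdge T f e).edgeSet then u a else 0) =
      (if a.1 ∈ T.edgeSet then u a else 0) - (if a = f then u a else 0) +
        (if a = e then u a else 0) := by
    intro a
    simp only [edgeSet_swapEdge T f.1 (G.not_isDiag_of_mem_edgeSet e.2), Set.mem_insert_iff,
      Set.mem_sdiff, Set.mem_singleton_iff, ← Subtype.ext_iff]
    grind
  simp only [totalLabel, Finset.sum_filter, hterm, Finset.sum_add_distrib, Finset.sum_sub_distrib,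
    Finset.sum_ite_eq', Finset.mem_univ, if_true]

open Classical in
/-- The edges of `G` outside `T`. -/
noncomputable def outerEdges (G T : SimpleGraph V) : Finset G.edgeSet :=
  {e | e.1 ∉ T.edgeSet}

lemma mem_outerEdges {e : G.edgeSet} : e ∈ outerEdges G T ↔ e.1 ∉ T.edgeSet := by
  simp [outerEdges]

/-- The number of independent cycles of a connected graph. The subtraction of natural numbers is
only truncated for disconnected graphs. -/
noncomputable def cyclomaticNumber (G : SimpleGraph V) : ℕ :=
  Nat.card G.edgeSet + 1 - Nat.card V

lemma card_outerEdges (hT : T ∈ spanningTrees G) :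
    (outerEdges G T).card = cyclomaticNumber G := by
  obtain ⟨hTG, hT⟩ := mem_spanningTrees.1 hT
  have himage : Subtype.val '' (outerEdges G T : Set G.edgeSet) = G.edgeSet \ T.edgeSet := by
    ext e
    simp [outerEdges, and_comm]
  have houter : (outerEdges G T).card = (G.edgeSet \ T.edgeSet).ncard := by
    rw [← himage, Set.ncard_image_of_injective _ Subtype.val_injective, Set.ncard_coe_finset]
  have hsplit := Set.ncard_sdiff_add_ncard_of_subset (SimpleGraph.edgeSet_mono hTG)
  have htree := (SimpleGraph.isTree_iff_connected_and_card.1 hT).2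
  simp only [cyclomaticNumber, Nat.card_coe_set_eq] at htree ⊢
  omega

end SpanningTrees

section Bottleneck

variable {V : Type*} [Fintype V] {G T T' : SimpleGraph V} {e f : G.edgeSet} {u : G.edgeSet → ℝ}

open Classical in
/-- The edges of `T` that can be exchanged for `e`: if `T` is a spanning tree and `e` is not an edge
of `T`, these are the edges of the path in `T` between the ends of `e`. -/
noncomputable def replaceable (G T : SimpleGraph V) (e : G.edgeSet) : Finset G.edgeSet :=
  {f | f.1 ∈ T.edgeSet ∧ (swapEdge T f e).IsTree}

lemma mem_replaceable :
    f ∈ replaceable G T e ↔ f.1 ∈ T.edgeSet ∧ (swapEdge T f e).IsTree := by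
  simp [replaceable]

/-- The largest label of an edge of `T` that can be exchanged for `e`. The value lies in `ℝ≥0`, so
that the supremum over any finite set makes sense; negative labels, which have probability `0`, are
replaced by `0`. -/
noncomputable def bottleneck (G T : SimpleGraph V) (e : G.edgeSet) (u : G.edgeSet → ℝ) : NNReal :=
  (replaceable G T e).sup fun f => (u f).toNNReal

/-- Every edge outside `T` has a larger label than the edges of `T` it can be exchanged for. -/
def IsStrictMin (G T : SimpleGraph V) (u : G.edgeSet → ℝ) : Prop :=
  ∀ e ∈ outerEdges G T, (bottleneck G T e u : ℝ) < u e

@[fun_prop]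
lemma measurable_bottleneck (G T : SimpleGraph V) (e : G.edgeSet) :
    Measurable (bottleneck G T e) := by
  have hsup : bottleneck G T e = (replaceable G T e).sup fun f u => (u f).toNNReal := by
    ext u
    rw [bottleneck, Finset.sup_apply]
  rw [hsup]
  exact Finset.sup_induction measurable_const (fun _ h _ h' => h.sup h')
    fun f _ => (measurable_pi_apply f).real_toNNReal

lemma measurableSet_isStrictMin (G T : SimpleGraph V) : MeasurableSet {u | IsStrictMin G T u} := by
  simp only [IsStrictMin, Set.ofPred_forall]
  exact .iInter fun e => .iInter fun _ => measurableSet_lt (by fun_prop) (by fun_prop)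

lemma dependsOn_bottleneck (G T : SimpleGraph V) (e : G.edgeSet) :
    DependsOn (bottleneck G T e) (↑(outerEdges G T))ᶜ := fun u v huv =>
  Finset.sup_congr rfl fun f hf => by
    rw [huv f fun hfT => mem_outerEdges.1 hfT (mem_replaceable.1 hf).1]

lemma le_bottleneck (hf : f ∈ replaceable G T e) (u : G.edgeSet → ℝ) :
    u f ≤ bottleneck G T e u :=
  (Real.le_coe_toNNReal _).trans <| NNReal.coe_le_coe.2 <|
    Finset.le_sup (f := fun f => (u f).toNNReal) hf

lemma exists_bottleneck_eq (hT : T ∈ spanningTrees G) (he : e ∈ outerEdges G T)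
    (hu : ∀ f, 0 < u f) : ∃ f ∈ replaceable G T e, (bottleneck G T e u : ℝ) = u f := by
  obtain ⟨hTG, hT⟩ := mem_spanningTrees.1 hT
  obtain ⟨f, hf, hfT⟩ :=
    exists_isTree_swapEdge_of_notMem hT (mem_outerEdges.1 he) (G.not_isDiag_of_mem_edgeSet e.2)
  obtain ⟨f', hf', h⟩ := Finset.exists_mem_eq_sup (replaceable G T e)
    ⟨⟨f, SimpleGraph.edgeSet_mono hTG hf⟩, mem_replaceable.2 ⟨hf, hfT⟩⟩ fun f => (u f).toNNReal
  exact ⟨f', hf', by rw [bottleneck, h, Real.coe_toNNReal _ (hu f').le]⟩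

lemma IsStrictMin.eq (h : IsStrictMin G T u) (h' : IsStrictMin G T' u)
    (hT : T ∈ spanningTrees G) (hT' : T' ∈ spanningTrees G) : T = T' := by
  by_contra hne
  obtain ⟨e, f, he, he', hf', hf, hTf, hTe⟩ := exists_isTree_swapEdge_of_ne hT hT' hne
  have hef : u e < u f :=
    (le_bottleneck (mem_replaceable.2 ⟨he, hTf⟩) u).trans_lt (h f (mem_outerEdges.2 hf))
  have hfe : u f < u e :=
    (le_bottleneck (mem_replaceable.2 ⟨hf', hTe⟩) u).trans_lt (h' e (mem_outerEdges.2 he'))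
  exact lt_asymm hef hfe

lemma MST_spec (hG : G.Connected) (u : G.edgeSet → ℝ) :
    MST G u ∈ spanningTrees G ∧
      ∀ T' ∈ spanningTrees G, totalLabel G u (MST G u) ≤ totalLabel G u T' :=
  Classical.epsilon_spec
    ((spanningTrees G).exists_min_image (totalLabel G u) (spanningTrees_nonempty hG))

lemma isStrictMin_MST (hG : G.Connected) (hu : ∀ e, 0 < u e) (hinj : Function.Injective u) :
    IsStrictMin G (MST G u) u := by
  intro e he
  obtain ⟨hM, hmin⟩ := MST_spec hG u
  obtain ⟨f, hf, h⟩ := exists_bottleneck_eq hM he hu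
  rw [mem_replaceable] at hf
  rw [mem_outerEdges] at he
  have hswap := hmin _ (swapEdge_mem_spanningTrees (mem_spanningTrees.1 hM).1 hf.2)
  rw [totalLabel_swapEdge he hf.1] at hswap
  have hne : u f ≠ u e := fun h' => he (hinj h' ▸ hf.1)
  rw [h]
  exact lt_of_le_of_ne (by linarith) hne

end Bottleneck

section Labels

variable {V : Type*} [Fintype V] {G : SimpleGraph V}

instance isProbabilityMeasure_restrict_Icc :
    IsProbabilityMeasure (volume.restrict (Set.Icc (0 : ℝ) 1)) := ⟨by simp⟩

lemma labelLaw_le_of_update [DecidableEq G.edgeSet] {s : Set (G.edgeSet → ℝ)}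
    (hs : MeasurableSet s) (e : G.edgeSet) (c : ℝ≥0∞)
    (h : ∀ u, volume (Function.update u e ⁻¹' s) ≤ c) : labelLaw G s ≤ c := by
  classical
  exact measure_pi_le_of_update _ hs e c fun u => (Measure.restrict_apply_le _ _).trans (h u)

lemma ae_labelLaw_pos (G : SimpleGraph V) : ∀ᵐ u ∂labelLaw G, ∀ e, 0 < u e := by
  classical
  have hpos : ∀ᵐ x ∂volume.restrict (Set.Icc (0 : ℝ) 1), 0 < x := by
    rw [← restrict_Ioc_eq_restrict_Icc]
    exact (ae_restrict_mem measurableSet_Ioc).mono fun x hx => hx.1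
  exact ae_all_iff.2 fun e => Measure.tendsto_eval_ae_ae.eventually hpos

lemma ae_labelLaw_injective (G : SimpleGraph V) :
    ∀ᵐ u ∂labelLaw G, Function.Injective u := by
  classical
  have hne (e f : G.edgeSet) (hef : e ≠ f) : ∀ᵐ u ∂labelLaw G, u e ≠ u f := by
    simp only [ae_iff, ne_eq, not_not]
    refine nonpos_iff_eq_zero.1 <| labelLaw_le_of_update
      (measurableSet_eq_fun (by fun_prop) (by fun_prop)) e 0 fun u => ?_
    refine (measure_mono (t := {u f}) fun x hx => ?_).trans (by simp)
    simpa [Function.update_of_ne hef.symm] using hx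
  simp only [Function.Injective, ae_all_iff]
  intro e f
  by_cases hef : e = f
  · exact .of_forall fun _ _ => hef
  · exact (hne e f hef).mono fun u hu h => absurd h hu

lemma ae_labelLaw_isStrictMin_MST (hG : G.Connected) :
    ∀ᵐ u ∂labelLaw G, IsStrictMin G (MST G u) u := by
  filter_upwards [ae_labelLaw_pos G, ae_labelLaw_injective G] with u hu hinj
  exact isStrictMin_MST hG hu hinj

end Labels

section Coupling

instance measurableSingletonClass_simpleGraph {V : Type*} [Finite V] :
    MeasurableSingletonClass (SimpleGraph V) := by
  refine ⟨fun T => ⟨{T.Adj}, measurableSet_singleton _, ?_⟩⟩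
  ext T'
  exact SimpleGraph.adj_inj

variable {V : Type*} [Fintype V] {G T : SimpleGraph V}

/-- `MST G u` depends on `u` only through the finitely many comparisons between total labels. -/
lemma measurable_MST (G : SimpleGraph V) : Measurable (MST G) := by
  let argmin (R : Set (SimpleGraph V × SimpleGraph V)) : SimpleGraph V :=
    Classical.epsilon fun T => T ∈ spanningTrees G ∧ ∀ T' ∈ spanningTrees G, (T, T') ∈ R
  have hcompare : Measurable fun u => {p : SimpleGraph V × SimpleGraph V |
      totalLabel G u p.1 ≤ totalLabel G u p.2} :=
    measurable_set_iff.2 fun p => measurableSet_setOfPred.1 <|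
      measurableSet_le (measurable_totalLabel G p.1) (measurable_totalLabel G p.2)
  exact (measurable_of_finite argmin).comp hcompare

lemma measurableSet_eq_MST (G : SimpleGraph V) :
    MeasurableSet {ω : (G.edgeSet → ℝ) × SimpleGraph V | ω.2 = MST G ω.1} :=
  measurableSet_eq_fun measurable_snd ((measurable_MST G).comp measurable_fst)

lemma wstKernel_apply_singleton (hT : T ∈ spanningTrees G) (β : ℝ) (u : G.edgeSet → ℝ) :
    wstKernel G β u {T} = ENNReal.ofReal (treeProb G β u T) := by
  classical
  simp [wstKernel, Measure.coe_finsetSum, Finset.sum_apply, Set.indicator_apply, hT]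

lemma coupling_eq_MST (hG : G.Connected) (β : ℝ) :
    coupling G β {ω | ω.2 = MST G ω.1} =
      ∫⁻ u, ENNReal.ofReal (treeProb G β u (MST G u)) ∂labelLaw G := by
  have := isMarkovKernel_wstKernel hG β
  rw [coupling, Measure.compProd_apply (measurableSet_eq_MST G)]
  exact lintegral_congr fun u => wstKernel_apply_singleton (MST_spec hG u).1 β u

lemma treeProb_nonneg (G T : SimpleGraph V) (β : ℝ) (u : G.edgeSet → ℝ) : 0 ≤ treeProb G β u T :=
  div_nonneg (Real.exp_pos _).le (Finset.sum_nonneg fun _ _ => (Real.exp_pos _).le)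

lemma coupling_ne_MST (hG : G.Connected) (β : ℝ) :
    coupling G β {ω | ω.2 ≠ MST G ω.1} =
      ∫⁻ u, ENNReal.ofReal (1 - treeProb G β u (MST G u)) ∂labelLaw G := by
  have := isMarkovKernel_wstKernel hG β
  rw [← Set.compl_ofPred, coupling, Measure.compProd_apply (measurableSet_eq_MST G).compl]
  refine lintegral_congr fun u => ?_
  calc wstKernel G β u {MST G u}ᶜ = 1 - ENNReal.ofReal (treeProb G β u (MST G u)) := by
        rw [prob_compl_eq_one_sub (measurableSet_singleton _),
          wstKernel_apply_singleton (MST_spec hG u).1]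
    _ = ENNReal.ofReal (1 - treeProb G β u (MST G u)) := by
        rw [ENNReal.ofReal_sub _ (treeProb_nonneg G _ β u), ENNReal.ofReal_one]

end Coupling

section LargeBeta

variable {V : Type*} [Fintype V] {G M T T' : SimpleGraph V} {β δ : ℝ} {u : G.edgeSet → ℝ}
  {e : G.edgeSet}

lemma exists_swapEdge_eq_totalLabel_add_le (hM : M ∈ spanningTrees G)
    (hgap : ∀ e ∈ outerEdges G M, bottleneck G M e u + δ ≤ u e)
    (hT : T ∈ spanningTrees G) (hne : T ≠ M) :
    ∃ T' ∈ spanningTrees G, ∃ f e : G.edgeSet, swapEdge T' f e = T ∧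
      totalLabel G u T' + δ ≤ totalLabel G u T := by
  obtain ⟨e, f, he, he', hf', hf, hTf, hMe⟩ := exists_isTree_swapEdge_of_ne hT hM hne
  refine ⟨swapEdge T e f, swapEdge_mem_spanningTrees (mem_spanningTrees.1 hT).1 hTf, f, e,
    swapEdge_swapEdge he hf (G.not_isDiag_of_mem_edgeSet f.2), ?_⟩
  have hfe : u f + δ ≤ u e :=
    (add_le_add_left (le_bottleneck (mem_replaceable.2 ⟨hf', hMe⟩) u) δ).trans
      (hgap e (mem_outerEdges.2 he'))
  rw [totalLabel_swapEdge hf he]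
  linarith

open Classical in
lemma sum_erase_exp_le (hβ : 0 ≤ β) (hM : M ∈ spanningTrees G)
    (hgap : ∀ e ∈ outerEdges G M, bottleneck G M e u + δ ≤ u e) :
    ∑ T ∈ (spanningTrees G).erase M, Real.exp (-β * totalLabel G u T) ≤
      (Nat.card G.edgeSet : ℝ) ^ 2 * Real.exp (-(β * δ)) * partitionFunction G β u := by
  let swaps : Finset (SimpleGraph V × G.edgeSet × G.edgeSet) := spanningTrees G ×ˢ Finset.univ
  let w (p : SimpleGraph V × G.edgeSet × G.edgeSet) : ℝ :=
    Real.exp (-(β * δ)) * Real.exp (-β * totalLabel G u p.1)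
  let swap (p : SimpleGraph V × G.edgeSet × G.edgeSet) : SimpleGraph V := swapEdge p.1 p.2.1 p.2.2
  have hw (p) : 0 ≤ w p := by positivity
  have hle : ∀ T ∈ (spanningTrees G).erase M,
      Real.exp (-β * totalLabel G u T) ≤ ∑ p ∈ swaps with swap p = T, w p := by
    intro T hT
    obtain ⟨hne, hT⟩ := Finset.mem_erase.1 hT
    obtain ⟨T', hT', f, e, hswap, hlabel⟩ :=
      exists_swapEdge_eq_totalLabel_add_le hM hgap hT hne
    calc Real.exp (-β * totalLabel G u T)
        ≤ Real.exp (-(β * δ)) * Real.exp (-β * totalLabel G u T') := by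
          rw [← Real.exp_add]
          exact Real.exp_le_exp.2 (by linarith [mul_le_mul_of_nonneg_left hlabel hβ])
      _ = w (T', f, e) := rfl
      _ ≤ ∑ p ∈ swaps with swap p = T, w p :=
          Finset.single_le_sum (fun p _ => hw p) (by simp [swaps, swap, hT', hswap])
  calc ∑ T ∈ (spanningTrees G).erase M, Real.exp (-β * totalLabel G u T)
      ≤ ∑ T ∈ (spanningTrees G).erase M, ∑ p ∈ swaps with swap p = T, w p :=
        Finset.sum_le_sum hle
    _ ≤ ∑ p ∈ swaps, w p :=
        Finset.sum_fiberwise_le_sum_of_sum_fiber_nonneg fun _ _ => Finset.sum_nonneg fun p _ => hw p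
    _ = (Nat.card G.edgeSet : ℝ) ^ 2 * Real.exp (-(β * δ)) * partitionFunction G β u := by
        simp only [swaps, w, Finset.sum_product, Finset.sum_const, Finset.card_univ,
          ← Nat.card_eq_fintype_card, Nat.card_prod, nsmul_eq_mul, Nat.cast_mul,
          partitionFunction, ← Finset.mul_sum]
        ring

lemma one_sub_treeProb_le (hβ : 0 ≤ β) (hM : M ∈ spanningTrees G)
    (hgap : ∀ e ∈ outerEdges G M, bottleneck G M e u + δ ≤ u e) :
    1 - treeProb G β u M ≤ (Nat.card G.edgeSet : ℝ) ^ 2 * Real.exp (-(β * δ)) := by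
  classical
  have hZ : 0 < partitionFunction G β u := Finset.sum_pos (fun _ _ => Real.exp_pos _) ⟨M, hM⟩
  rw [treeProb, one_sub_div hZ.ne', div_le_iff₀ hZ]
  refine le_trans (le_of_eq ?_) (sum_erase_exp_le hβ hM hgap)
  exact sub_eq_iff_eq_add'.2 (Finset.add_sum_erase _ _ hM).symm

/-- The labels for which the edge `e` is outside a strictly minimal tree but within `δ` of
entering it. -/
def nearTie (G : SimpleGraph V) (δ : ℝ) (e : G.edgeSet) : Set (G.edgeSet → ℝ) :=
  {u | ∃ T ∈ spanningTrees G, e ∈ outerEdges G T ∧ IsStrictMin G T u ∧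
    u e < bottleneck G T e u + δ}

lemma measurableSet_nearTie (G : SimpleGraph V) (δ : ℝ) (e : G.edgeSet) :
    MeasurableSet (nearTie G δ e) := by
  have hlt (T : SimpleGraph V) : MeasurableSet {u | u e < bottleneck G T e u + δ} :=
    measurableSet_lt (by fun_prop) (by fun_prop)
  have := measurableSet_isStrictMin G
  simp only [nearTie, measurableSet_setOfPred] at *
  fun_prop

lemma bottleneck_update [DecidableEq G.edgeSet] (he : e ∈ outerEdges G T) (e' : G.edgeSet)
    (u : G.edgeSet → ℝ) (x : ℝ) :
    bottleneck G T e' (Function.update u e x) = bottleneck G T e' u :=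
  dependsOn_bottleneck G T e' fun _ hf =>
    Function.update_of_ne (ne_of_mem_of_not_mem (Finset.mem_coe.2 he) hf).symm _ _

lemma IsStrictMin.update_of_le [DecidableEq G.edgeSet] (he : e ∈ outerEdges G T) {x y : ℝ}
    (hxy : x ≤ y) (h : IsStrictMin G T (Function.update u e x)) :
    IsStrictMin G T (Function.update u e y) := by
  intro e' he'
  have := h e' he'
  rw [bottleneck_update he] at this ⊢
  exact this.trans_le (update_le_update_iff.2 ⟨hxy, fun _ _ => le_rfl⟩ e')

/-- Raising the label of an outer edge preserves strict minimality, so along the coordinate `e` all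
near ties come from one tree, whose bottleneck at `e` does not depend on the label of `e`. -/
lemma labelLaw_nearTie_le (G : SimpleGraph V) (δ : ℝ) (e : G.edgeSet) :
    labelLaw G (nearTie G δ e) ≤ ENNReal.ofReal δ := by
  classical
  refine labelLaw_le_of_update (measurableSet_nearTie G δ e) e _ fun u =>
    (Real.volume_le_diam _).trans ?_
  have hsub : ∀ x ∈ Function.update u e ⁻¹' nearTie G δ e,
      ∀ y ∈ Function.update u e ⁻¹' nearTie G δ e, x ≤ y → y - x ≤ δ := by
    rintro x ⟨T, hT, heT, hTx, -⟩ y ⟨T', hT', heT', hTy, hlt⟩ hxy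
    obtain rfl : T = T' := (hTx.update_of_le heT hxy).eq hTy hT hT'
    have hx := hTx e heT
    rw [bottleneck_update heT, Function.update_self] at hx hlt
    linarith
  refine Metric.ediam_le fun x hx y hy => ?_
  rw [edist_dist, Real.dist_eq]
  refine ENNReal.ofReal_le_ofReal ?_
  rcases le_total x y with h | h
  · rw [abs_sub_comm, abs_of_nonneg (sub_nonneg.2 h)]
    exact hsub x hx y hy h
  · rw [abs_of_nonneg (sub_nonneg.2 h)]
    exact hsub y hy x hx h

lemma labelLaw_iUnion_nearTie_le (G : SimpleGraph V) (δ : ℝ) :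
    labelLaw G (⋃ e, nearTie G δ e) ≤ ENNReal.ofReal (Nat.card G.edgeSet * δ) := by
  classical
  calc labelLaw G (⋃ e, nearTie G δ e) ≤ ∑ e, labelLaw G (nearTie G δ e) :=
        measure_iUnion_fintype_le _ _
    _ ≤ ∑ _e : G.edgeSet, ENNReal.ofReal δ :=
        Finset.sum_le_sum fun e _ => labelLaw_nearTie_le G δ e
    _ = ENNReal.ofReal (Nat.card G.edgeSet * δ) := by
        simp [ENNReal.ofReal_mul, Nat.card_eq_fintype_card]

lemma coupling_ne_MST_le (hG : G.Connected) (hβ : 0 ≤ β) (hδ : 0 ≤ δ) :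
    coupling G β {ω | ω.2 ≠ MST G ω.1} ≤ ENNReal.ofReal
      (Nat.card G.edgeSet * δ + (Nat.card G.edgeSet : ℝ) ^ 2 * Real.exp (-(β * δ))) := by
  set η : ℝ := (Nat.card G.edgeSet : ℝ) ^ 2 * Real.exp (-(β * δ))
  set B : Set (G.edgeSet → ℝ) := ⋃ e, nearTie G δ e
  have hB : MeasurableSet B := .iUnion fun e => measurableSet_nearTie G δ e
  have hle : ∀ᵐ u ∂labelLaw G, ENNReal.ofReal (1 - treeProb G β u (MST G u)) ≤
      B.indicator 1 u + ENNReal.ofReal η := by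
    filter_upwards [ae_labelLaw_isStrictMin_MST hG] with u hu
    by_cases huB : u ∈ B
    · rw [Set.indicator_of_mem huB]
      exact le_add_right <| ENNReal.ofReal_le_one.2 <|
        sub_le_self _ (treeProb_nonneg G _ β u)
    · rw [Set.indicator_of_notMem huB, zero_add]
      refine ENNReal.ofReal_le_ofReal (one_sub_treeProb_le hβ (MST_spec hG u).1 fun e he => ?_)
      by_contra! hlt
      exact huB (Set.mem_iUnion.2 ⟨e, MST G u, (MST_spec hG u).1, he, hu, hlt⟩)
  calc coupling G β {ω | ω.2 ≠ MST G ω.1}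
      = ∫⁻ u, ENNReal.ofReal (1 - treeProb G β u (MST G u)) ∂labelLaw G := coupling_ne_MST hG β
    _ ≤ ∫⁻ u, (B.indicator 1 u + ENNReal.ofReal η) ∂labelLaw G := lintegral_mono_ae hle
    _ = labelLaw G B + ENNReal.ofReal η := by
        rw [lintegral_add_right _ measurable_const, lintegral_indicator_one hB, lintegral_const,
          measure_univ, mul_one]
    _ ≤ ENNReal.ofReal (Nat.card G.edgeSet * δ) + ENNReal.ofReal η := by
        gcongr
        exact labelLaw_iUnion_nearTie_le G δ
    _ = ENNReal.ofReal (Nat.card G.edgeSet * δ + η) :=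
        (ENNReal.ofReal_add (by positivity) (by positivity)).symm

/-- This is `coupling_ne_MST_le` for `δ = 3 log m / β`, where `m` is the number of edges. -/
lemma coupling_ne_MST_le_mul_log_div_add_inv (hG : G.Connected) (hβ : 0 < β) :
    coupling G β {ω | ω.2 ≠ MST G ω.1} ≤ ENNReal.ofReal
      (3 * (Nat.card G.edgeSet * Real.log (Nat.card G.edgeSet) / β) +
        (Nat.card G.edgeSet : ℝ)⁻¹) := by
  have hδ : 0 ≤ 3 * Real.log (Nat.card G.edgeSet) / β :=
    div_nonneg (mul_nonneg zero_le_three (Real.log_natCast_nonneg _)) hβ.le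
  refine (coupling_ne_MST_le hG hβ.le hδ).trans_eq ?_
  rcases (Nat.card G.edgeSet).eq_zero_or_pos with h | h
  · simp [h]
  · have hm : (0 : ℝ) < Nat.card G.edgeSet := Nat.cast_pos.2 h
    have hexp : Real.exp (-(3 * Real.log (Nat.card G.edgeSet))) =
        ((Nat.card G.edgeSet : ℝ) ^ 3)⁻¹ := by
      rw [Real.exp_neg, mul_comm, Real.exp_mul, Real.exp_log hm]
      norm_cast
    rw [mul_div_cancel₀ _ hβ.ne', hexp]
    congr 1
    field_simp

lemma tendsto_coupling_ne_MST {ι : Type*} {l : Filter ι} {V : ι → Type*} [∀ i, Fintype (V i)]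
    {G : ∀ i, SimpleGraph (V i)} {β : ι → ℝ} (hG : ∀ᶠ i in l, (G i).Connected)
    (hβ : ∀ᶠ i in l, 0 ≤ β i) (hm : Tendsto (fun i => Nat.card (G i).edgeSet) l atTop)
    (h : (fun i => (Nat.card (G i).edgeSet : ℝ) * Real.log (Nat.card (G i).edgeSet)) =o[l] β) :
    Tendsto (fun i => coupling (G i) (β i) {ω | ω.2 ≠ MST (G i) ω.1}) l (𝓝 0) := by
  have hinv : Tendsto (fun i => (Nat.card (G i).edgeSet : ℝ)⁻¹) l (𝓝 0) :=
    (tendsto_natCast_atTop_atTop.comp hm).inv_tendsto_atTop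
  have hlim := ENNReal.tendsto_ofReal ((h.tendsto_div_nhds_zero.const_mul 3).add hinv)
  rw [mul_zero, add_zero, ENNReal.ofReal_zero] at hlim
  refine tendsto_of_tendsto_of_tendsto_of_le_of_le' tendsto_const_nhds hlim
    (.of_forall fun _ => zero_le) ?_
  filter_upwards [hG, hβ, hm.eventually_gt_atTop 1, h.bound one_pos] with i hGi hβi hmi hbound
  have hm1 : (1 : ℝ) < Nat.card (G i).edgeSet := Nat.one_lt_cast.2 hmi
  have hpos : (0 : ℝ) < Nat.card (G i).edgeSet * Real.log (Nat.card (G i).edgeSet) :=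
    mul_pos (zero_lt_one.trans hm1) (Real.log_pos hm1)
  have hβ0 : 0 < β i := hβi.lt_of_ne' fun h0 => hpos.ne' <| norm_le_zero_iff.1 <| by
    simpa only [h0, norm_zero, mul_zero] using hbound
  exact coupling_ne_MST_le_mul_log_div_add_inv hGi hβ0

end LargeBeta

section SmallBeta

variable {V : Type*} [Fintype V] {G T : SimpleGraph V} {β : ℝ} {u : G.edgeSet → ℝ}

/-- The total weight, relative to that of `T`, of the trees obtained from `T` by inserting an edge
and deleting an edge with the largest label on the resulting cycle. -/
noncomputable def exchangeWeight (G T : SimpleGraph V) (β : ℝ) (u : G.edgeSet → ℝ) : ℝ :=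
  ∑ e ∈ outerEdges G T, Real.exp (-(β * (u e - bottleneck G T e u)))

lemma exchangeWeight_nonneg (G T : SimpleGraph V) (β : ℝ) (u : G.edgeSet → ℝ) :
    0 ≤ exchangeWeight G T β u :=
  Finset.sum_nonneg fun _ _ => (Real.exp_pos _).le

lemma injOn_swapEdge (T : SimpleGraph V) (F : G.edgeSet → Sym2 V) :
    Set.InjOn (fun e : G.edgeSet => swapEdge T (F e) e) (outerEdges G T) := by
  intro e he e' _ (heq : swapEdge T (F e) e = swapEdge T (F e') e')
  have hmem := heq ▸ mem_edgeSet_swapEdge T (F e) (G.not_isDiag_of_mem_edgeSet e.2)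
  rw [edgeSet_swapEdge _ _ (G.not_isDiag_of_mem_edgeSet e'.2)] at hmem
  exact hmem.elim Subtype.ext fun h => absurd h.1 (mem_outerEdges.1 he)

lemma exp_mul_one_add_exchangeWeight_le (hT : T ∈ spanningTrees G) (β : ℝ)
    (hu : ∀ e, 0 < u e) :
    Real.exp (-β * totalLabel G u T) * (1 + exchangeWeight G T β u) ≤
      partitionFunction G β u := by
  classical
  have hexists : ∀ e ∈ outerEdges G T, ∃ f ∈ replaceable G T e,
      (bottleneck G T e u : ℝ) = u f := fun e he => exists_bottleneck_eq hT he hu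
  choose! F hF hFu using hexists
  have hsub : (outerEdges G T).image (fun e => swapEdge T (F e) e) ⊆ (spanningTrees G).erase T := by
    refine Finset.image_subset_iff.2 fun e he => Finset.mem_erase.2 ⟨fun h => ?_, ?_⟩
    · have he' := mem_edgeSet_swapEdge T (F e) (G.not_isDiag_of_mem_edgeSet e.2)
      exact mem_outerEdges.1 he (h ▸ he')
    · exact swapEdge_mem_spanningTrees (mem_spanningTrees.1 hT).1 (mem_replaceable.1 (hF e he)).2
  have hswap : ∀ e ∈ outerEdges G T, Real.exp (-β * totalLabel G u (swapEdge T (F e) e)) =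
      Real.exp (-β * totalLabel G u T) * Real.exp (-(β * (u e - bottleneck G T e u))) := by
    intro e he
    rw [totalLabel_swapEdge (mem_outerEdges.1 he) (mem_replaceable.1 (hF e he)).1, hFu e he,
      ← Real.exp_add]
    ring_nf
  calc Real.exp (-β * totalLabel G u T) * (1 + exchangeWeight G T β u)
      = Real.exp (-β * totalLabel G u T) +
          ∑ e ∈ outerEdges G T, Real.exp (-β * totalLabel G u (swapEdge T (F e) e)) := by
        rw [mul_add, mul_one, exchangeWeight, Finset.mul_sum, Finset.sum_congr rfl hswap]
    _ = Real.exp (-β * totalLabel G u T) + ∑ T' ∈ (outerEdges G T).image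
          (fun e => swapEdge T (F e) e), Real.exp (-β * totalLabel G u T') := by
        rw [Finset.sum_image (injOn_swapEdge T fun e => F e)]
    _ ≤ Real.exp (-β * totalLabel G u T) +
          ∑ T' ∈ (spanningTrees G).erase T, Real.exp (-β * totalLabel G u T') := by
        gcongr
    _ = partitionFunction G β u :=
        Finset.add_sum_erase _ (fun T => Real.exp (-β * totalLabel G u T)) hT

lemma treeProb_le_one_div_one_add_exchangeWeight (hT : T ∈ spanningTrees G) (β : ℝ)
    (hu : ∀ e, 0 < u e) : treeProb G β u T ≤ 1 / (1 + exchangeWeight G T β u) := by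
  have hS : 0 < 1 + exchangeWeight G T β u :=
    add_pos_of_pos_of_nonneg one_pos (exchangeWeight_nonneg G T β u)
  have hle := exp_mul_one_add_exchangeWeight_le hT β hu
  rw [treeProb, div_le_div_iff₀ ((mul_pos (Real.exp_pos _) hS).trans_le hle) hS, one_mul]
  exact hle

lemma prod_outerEdges_indicator (G T : SimpleGraph V) (h : ℝ → ℝ → ℝ≥0∞) (u : G.edgeSet → ℝ) :
    ∏ e ∈ outerEdges G T, (Set.Ioi (bottleneck G T e u : ℝ)).indicator
        (h (bottleneck G T e u)) (u e) =
      {u | IsStrictMin G T u}.indicator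
        (fun u => ∏ e ∈ outerEdges G T, h (bottleneck G T e u) (u e)) u := by
  by_cases hu : IsStrictMin G T u
  · rw [Set.indicator_of_mem (Set.mem_ofPred.2 hu)]
    exact Finset.prod_congr rfl fun e he => Set.indicator_of_mem (Set.mem_Ioi.2 (hu e he)) _
  · rw [Set.indicator_of_notMem (mt Set.mem_ofPred.1 hu)]
    obtain ⟨e, he, hle⟩ : ∃ e ∈ outerEdges G T, ¬ (bottleneck G T e u : ℝ) < u e := by
      simpa [IsStrictMin] using hu
    exact Finset.prod_eq_zero he (Set.indicator_of_notMem hle _)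

lemma setLIntegral_Icc_indicator_Ioi {a b c : ℝ} (h : a ≤ c) (f : ℝ → ℝ≥0∞) :
    ∫⁻ x in Set.Icc a b, (Set.Ioi c).indicator f x = ∫⁻ x in Set.Ioc c b, f x := by
  rw [setLIntegral_indicator measurableSet_Ioi]
  congr 2
  ext x
  exact ⟨fun hx => ⟨hx.1, hx.2.2⟩, fun hx => ⟨hx.1, h.trans hx.1.le, hx.2⟩⟩

/-- Given the labels on `T`, the labels outside `T` are independent and `IsStrictMin G T` asks each
of them to exceed its bottleneck, so both sides split over the edges outside `T`. -/
lemma setLIntegral_isStrictMin_prod_le (G T : SimpleGraph V) {h : ℝ → ℝ → ℝ≥0∞}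
    (hh : Measurable (Function.uncurry h)) {c : ℝ≥0∞}
    (hc : ∀ b, 0 ≤ b → ∫⁻ x in Set.Ioc b 1, h b x ≤ c * volume (Set.Ioc b 1)) :
    ∫⁻ u in {u | IsStrictMin G T u},
        ∏ e ∈ outerEdges G T, h (bottleneck G T e u) (u e) ∂labelLaw G ≤
      c ^ (outerEdges G T).card * labelLaw G {u | IsStrictMin G T u} := by
  classical
  let truncated (h : ℝ → ℝ → ℝ≥0∞) (e : G.edgeSet) (u : G.edgeSet → ℝ) : ℝ → ℝ≥0∞ :=
    (Set.Ioi (bottleneck G T e u : ℝ)).indicator (h (bottleneck G T e u))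
  have hmeas {h : ℝ → ℝ → ℝ≥0∞} (hh : Measurable (Function.uncurry h)) (e) :
      Measurable fun u => truncated h e u (u e) :=
    Measurable.indicator (f := fun u => h (bottleneck G T e u) (u e))
      (hh.comp (by fun_prop : Measurable fun u => ((bottleneck G T e u : ℝ), u e)))
      (measurableSet_lt (by fun_prop) (by fun_prop))
  have hdep (h) (e) : DependsOn (truncated h e) (↑(outerEdges G T))ᶜ := fun u v huv => by
    simp only [truncated, dependsOn_bottleneck G T e huv]
  have hsection (e) (u) : ∫⁻ x in Set.Icc 0 1, truncated h e u x ≤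
      c * ∫⁻ x in Set.Icc 0 1, truncated 1 e u x := by
    have hb : (0 : ℝ) ≤ bottleneck G T e u := NNReal.coe_nonneg _
    simp only [truncated, setLIntegral_Icc_indicator_Ioi hb, Pi.one_apply, setLIntegral_one]
    exact hc _ hb
  have hsplit (h : ℝ → ℝ → ℝ≥0∞) : ∫⁻ u, ∏ e ∈ outerEdges G T, truncated h e u (u e) ∂labelLaw G =
      ∫⁻ u in {u | IsStrictMin G T u},
        ∏ e ∈ outerEdges G T, h (bottleneck G T e u) (u e) ∂labelLaw G := by
    simp only [truncated, prod_outerEdges_indicator,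
      lintegral_indicator (measurableSet_isStrictMin G T)]
  have hle : ∫⁻ u, ∏ e ∈ outerEdges G T, truncated h e u (u e) ∂labelLaw G ≤
      c ^ (outerEdges G T).card *
        ∫⁻ u, ∏ e ∈ outerEdges G T, truncated 1 e u (u e) ∂labelLaw G :=
    lintegral_prod_le_pow_mul (fun e _ => hmeas hh e) (fun e _ => hmeas measurable_one e)
      (fun e _ => hdep h e) (fun e _ => hdep 1 e) fun e _ u => hsection e u
  simpa only [hsplit, Pi.one_apply, Finset.prod_const_one, setLIntegral_one] using hle

lemma setLIntegral_exp_neg_exchangeWeight_le (hT : T ∈ spanningTrees G) (β : ℝ) :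
    ∫⁻ u in {u | IsStrictMin G T u},
        ENNReal.ofReal (Real.exp (-exchangeWeight G T β u)) ∂labelLaw G ≤
      ENNReal.ofReal (Real.exp (-(cyclomaticNumber G / (4 * (1 + |β|))))) *
        labelLaw G {u | IsStrictMin G T u} := by
  let h (b x : ℝ) : ℝ≥0∞ := ENNReal.ofReal (Real.exp (-Real.exp (-(β * (x - b)))))
  calc ∫⁻ u in {u | IsStrictMin G T u},
        ENNReal.ofReal (Real.exp (-exchangeWeight G T β u)) ∂labelLaw G
      = ∫⁻ u in {u | IsStrictMin G T u},
          ∏ e ∈ outerEdges G T, h (bottleneck G T e u) (u e) ∂labelLaw G := by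
        simp only [h, exchangeWeight, ← Finset.sum_neg_distrib, Real.exp_sum,
          ENNReal.ofReal_prod_of_nonneg fun _ _ => (Real.exp_pos _).le]
    _ ≤ ENNReal.ofReal (Real.exp (-(1 / (4 * (1 + |β|))))) ^ (outerEdges G T).card *
          labelLaw G {u | IsStrictMin G T u} :=
        setLIntegral_isStrictMin_prod_le G T (by fun_prop) fun b hb =>
          setLIntegral_Ioc_exp_neg_exp_le β (le_add_of_nonneg_left hb)
    _ = ENNReal.ofReal (Real.exp (-(cyclomaticNumber G / (4 * (1 + |β|))))) *
          labelLaw G {u | IsStrictMin G T u} := by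
        rw [← ENNReal.ofReal_pow (Real.exp_pos _).le, ← Real.exp_nat_mul, card_outerEdges hT,
          mul_neg, mul_one_div]

lemma lintegral_eq_sum_setLIntegral_isStrictMin (hG : G.Connected) (f : (G.edgeSet → ℝ) → ℝ≥0∞) :
    ∫⁻ u, f u ∂labelLaw G =
      ∑ T ∈ spanningTrees G, ∫⁻ u in {u | IsStrictMin G T u}, f u ∂labelLaw G := by
  have hcover : (⋃ T ∈ spanningTrees G, {u | IsStrictMin G T u}) =ᵐ[labelLaw G] Set.univ := by
    refine eventuallyEq_univ.2 ?_
    filter_upwards [ae_labelLaw_isStrictMin_MST hG] with u hu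
    exact Set.mem_biUnion (MST_spec hG u).1 hu
  rw [← setLIntegral_univ, ← setLIntegral_congr hcover]
  exact lintegral_biUnion_finset (s := spanningTrees G) (t := fun T => {u | IsStrictMin G T u})
    (fun T hT T' hT' hne => Set.disjoint_left.2 fun _ h h' => hne (h.eq h' hT hT'))
    (fun T _ => measurableSet_isStrictMin G T) f

lemma setLIntegral_treeProb_MST_le (hG : G.Connected) (hT : T ∈ spanningTrees G) (β : ℝ) :
    ∫⁻ u in {u | IsStrictMin G T u}, ENNReal.ofReal (treeProb G β u (MST G u)) ∂labelLaw G ≤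
      ENNReal.ofReal (1 / (1 + cyclomaticNumber G / (8 * (1 + |β|))) +
        Real.exp (-(cyclomaticNumber G / (8 * (1 + |β|))))) *
          labelLaw G {u | IsStrictMin G T u} := by
  set A : ℝ := cyclomaticNumber G / (8 * (1 + |β|)) with hA
  have hA2 : 2 * A = cyclomaticNumber G / (4 * (1 + |β|)) := by
    rw [hA]
    field_simp
    ring
  have hA0 : 0 ≤ A := by positivity
  have hle : ∀ᵐ u ∂(labelLaw G).restrict {u | IsStrictMin G T u},
      ENNReal.ofReal (treeProb G β u (MST G u)) ≤ ENNReal.ofReal (1 / (1 + A)) +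
        ENNReal.ofReal (Real.exp A) * ENNReal.ofReal (Real.exp (-exchangeWeight G T β u)) := by
    refine (ae_restrict_iff' (measurableSet_isStrictMin G T)).2 ?_
    filter_upwards [ae_labelLaw_isStrictMin_MST hG, ae_labelLaw_pos G] with u hMST hu hTu
    rw [hMST.eq hTu (MST_spec hG u).1 hT, ← ENNReal.ofReal_mul (Real.exp_pos A).le,
      ← ENNReal.ofReal_add (by positivity) (by positivity)]
    exact ENNReal.ofReal_le_ofReal <|
      (treeProb_le_one_div_one_add_exchangeWeight hT β hu).trans
        (one_div_one_add_le hA0 (exchangeWeight_nonneg G T β u))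
  refine (lintegral_mono_ae hle).trans ?_
  rw [lintegral_add_left measurable_const, setLIntegral_const,
    lintegral_const_mul' _ _ ENNReal.ofReal_ne_top, ENNReal.ofReal_add (by positivity)
    (by positivity), add_mul]
  refine add_le_add_right ?_ _
  calc ENNReal.ofReal (Real.exp A) * ∫⁻ u in {u | IsStrictMin G T u},
          ENNReal.ofReal (Real.exp (-exchangeWeight G T β u)) ∂labelLaw G
      ≤ ENNReal.ofReal (Real.exp A) * (ENNReal.ofReal (Real.exp (-(2 * A))) *
          labelLaw G {u | IsStrictMin G T u}) := by
        gcongr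
        rw [hA2]
        exact setLIntegral_exp_neg_exchangeWeight_le hT β
    _ = ENNReal.ofReal (Real.exp (-A)) * labelLaw G {u | IsStrictMin G T u} := by
        rw [← mul_assoc, ← ENNReal.ofReal_mul (Real.exp_pos A).le, ← Real.exp_add]
        ring_nf

lemma coupling_eq_MST_le (hG : G.Connected) (β : ℝ) :
    coupling G β {ω | ω.2 = MST G ω.1} ≤
      ENNReal.ofReal (1 / (1 + cyclomaticNumber G / (8 * (1 + |β|))) +
        Real.exp (-(cyclomaticNumber G / (8 * (1 + |β|))))) := by
  set c := ENNReal.ofReal (1 / (1 + cyclomaticNumber G / (8 * (1 + |β|))) +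
    Real.exp (-(cyclomaticNumber G / (8 * (1 + |β|)))))
  calc coupling G β {ω | ω.2 = MST G ω.1}
      = ∫⁻ u, ENNReal.ofReal (treeProb G β u (MST G u)) ∂labelLaw G := coupling_eq_MST hG β
    _ = ∑ T ∈ spanningTrees G, ∫⁻ u in {u | IsStrictMin G T u},
          ENNReal.ofReal (treeProb G β u (MST G u)) ∂labelLaw G :=
        lintegral_eq_sum_setLIntegral_isStrictMin hG _
    _ ≤ ∑ T ∈ spanningTrees G, ∫⁻ _ in {u | IsStrictMin G T u}, c ∂labelLaw G :=
        Finset.sum_le_sum fun T hT =>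
          (setLIntegral_treeProb_MST_le hG hT β).trans_eq (setLIntegral_const _ _).symm
    _ = ∫⁻ _, c ∂labelLaw G := (lintegral_eq_sum_setLIntegral_isStrictMin hG _).symm
    _ = c := by rw [lintegral_const, measure_univ, mul_one]

lemma tendsto_coupling_eq_MST {ι : Type*} {l : Filter ι} {V : ι → Type*} [∀ i, Fintype (V i)]
    {G : ∀ i, SimpleGraph (V i)} {β : ι → ℝ} (hG : ∀ᶠ i in l, (G i).Connected)
    (hk : Tendsto (fun i => cyclomaticNumber (G i)) l atTop)
    (h : β =o[l] fun i => (cyclomaticNumber (G i) : ℝ)) :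
    Tendsto (fun i => coupling (G i) (β i) {ω | ω.2 = MST (G i) ω.1}) l (𝓝 0) := by
  have hkR : Tendsto (fun i => (cyclomaticNumber (G i) : ℝ)) l atTop :=
    tendsto_natCast_atTop_atTop.comp hk
  have hratio : Tendsto (fun i => 8 * (1 + |β i|) / cyclomaticNumber (G i)) l (𝓝[>] 0) := by
    have hsmall : (fun i => 8 * (1 + |β i|)) =o[l] fun i => (cyclomaticNumber (G i) : ℝ) :=
      (((isLittleO_const_left_of_ne one_ne_zero).2 (tendsto_norm_atTop_atTop.comp hkR)).add
        h.abs_left).const_mul_left 8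
    refine tendsto_nhdsWithin_iff.2 ⟨hsmall.tendsto_div_nhds_zero, ?_⟩
    filter_upwards [hkR.eventually_gt_atTop 0] with i hi
    exact div_pos (by positivity) hi
  have htop : Tendsto (fun i => cyclomaticNumber (G i) / (8 * (1 + |β i|))) l atTop :=
    hratio.inv_tendsto_nhdsGT_zero.congr fun i => inv_div _ _
  have hinv : Tendsto (fun x : ℝ => 1 / (1 + x)) atTop (𝓝 0) :=
    (tendsto_atTop_add_const_left atTop (1 : ℝ) tendsto_id).inv_tendsto_atTop.congr
      fun x => (one_div _).symm
  have hlim := ENNReal.tendsto_ofReal <|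
    (hinv.add Real.tendsto_exp_neg_atTop_nhds_zero).comp htop
  rw [add_zero, ENNReal.ofReal_zero] at hlim
  refine tendsto_of_tendsto_of_tendsto_of_le_of_le' tendsto_const_nhds hlim
    (.of_forall fun _ => zero_le) ?_
  filter_upwards [hG] with i hGi
  exact coupling_eq_MST_le hGi (β i)

end SmallBeta

section CompleteGraph

lemma card_edgeSet_top (V : Type*) [Fintype V] :
    Nat.card (⊤ : SimpleGraph V).edgeSet = (Fintype.card V).choose 2 := by
  classical
  rw [Nat.card_eq_fintype_card, ← SimpleGraph.edgeFinset_card,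
    SimpleGraph.card_edgeFinset_top_eq_card_choose_two]

lemma eventually_connected_top_fin : ∀ᶠ n in atTop, (⊤ : SimpleGraph (Fin n)).Connected := by
  filter_upwards [eventually_ge_atTop 1] with n hn
  have : Nonempty (Fin n) := ⟨⟨0, hn⟩⟩
  exact SimpleGraph.connected_top

lemma sq_div_eight_le_cyclomaticNumber_top {n : ℕ} (hn : 4 ≤ n) :
    (n : ℝ) ^ 2 / 8 ≤ cyclomaticNumber (⊤ : SimpleGraph (Fin n)) := by
  have hcard : (n.choose 2 : ℝ) + 1 - n ≤ cyclomaticNumber (⊤ : SimpleGraph (Fin n)) := by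
    rw [cyclomaticNumber, card_edgeSet_top, Nat.card_fin, Fintype.card_fin, sub_le_iff_le_add]
    exact_mod_cast le_tsub_add
  refine le_trans ?_ hcard
  obtain ⟨k, rfl⟩ := Nat.exists_eq_add_of_le hn
  rw [Nat.cast_choose_two]
  push_cast
  nlinarith [k.cast_nonneg (α := ℝ)]

lemma isBigO_sq_cyclomaticNumber_top : (fun n : ℕ => (n : ℝ) ^ 2) =O[atTop]
    fun n : ℕ => (cyclomaticNumber (⊤ : SimpleGraph (Fin n)) : ℝ) := by
  refine .of_bound 8 ?_
  filter_upwards [eventually_ge_atTop 4] with n hn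
  rw [Real.norm_of_nonneg (by positivity), Real.norm_natCast]
  linarith [sq_div_eight_le_cyclomaticNumber_top hn]

lemma tendsto_cyclomaticNumber_top :
    Tendsto (fun n : ℕ => cyclomaticNumber (⊤ : SimpleGraph (Fin n))) atTop atTop := by
  refine tendsto_natCast_atTop_iff (R := ℝ) |>.1 ?_
  refine tendsto_atTop_mono' _ ((eventually_ge_atTop 4).mono fun n hn =>
    sq_div_eight_le_cyclomaticNumber_top hn) ?_
  exact ((tendsto_pow_atTop two_ne_zero).comp tendsto_natCast_atTop_atTop).atTop_div_const
    (by norm_num)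

lemma tendsto_card_edgeSet_top :
    Tendsto (fun n : ℕ => Nat.card (⊤ : SimpleGraph (Fin n)).edgeSet) atTop atTop := by
  refine tendsto_atTop_mono' _ ((eventually_ge_atTop 1).mono fun n hn => ?_)
    tendsto_cyclomaticNumber_top
  simp only [cyclomaticNumber, Nat.card_fin]
  omega

lemma isBigO_card_edgeSet_top_mul_log :
    (fun n : ℕ => (Nat.card (⊤ : SimpleGraph (Fin n)).edgeSet : ℝ) *
      Real.log (Nat.card (⊤ : SimpleGraph (Fin n)).edgeSet)) =O[atTop]
        fun n : ℕ => (n : ℝ) ^ 2 * Real.log n := by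
  refine .of_bound 2 ?_
  filter_upwards [tendsto_card_edgeSet_top.eventually_ge_atTop 1] with n hn
  have hle : (Nat.card (⊤ : SimpleGraph (Fin n)).edgeSet : ℝ) ≤ (n : ℝ) ^ 2 := by
    rw [card_edgeSet_top, Fintype.card_fin]
    exact_mod_cast Nat.choose_le_pow n 2
  have hlog : Real.log (Nat.card (⊤ : SimpleGraph (Fin n)).edgeSet) ≤ 2 * Real.log n := by
    rw [← Nat.cast_ofNat, ← Real.log_pow]
    exact Real.log_le_log (Nat.cast_pos.2 hn) hle
  have hlog0 := Real.log_natCast_nonneg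
  rw [Real.norm_of_nonneg (mul_nonneg (Nat.cast_nonneg _) (hlog0 _)),
    Real.norm_of_nonneg (mul_nonneg (by positivity) (hlog0 n)), mul_left_comm]
  exact mul_le_mul hle hlog (hlog0 _) (by positivity)

end CompleteGraph

end RandomSpanningTree

open RandomSpanningTree in
theorem mainTheorem4_general {ι : Type*} {l : Filter ι} {V : ι → Type*} [∀ i, Fintype (V i)]
    {G : ∀ i, SimpleGraph (V i)} (hG : ∀ᶠ i in l, (G i).Connected) (β : ι → ℝ) :
    ((∀ᶠ i in l, 0 ≤ β i) → Tendsto (fun i => Nat.card (G i).edgeSet) l atTop →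
      (fun i => (Nat.card (G i).edgeSet : ℝ) * Real.log (Nat.card (G i).edgeSet)) =o[l] β →
      Tendsto (fun i => coupling (G i) (β i) {ω | ω.2 = MST (G i) ω.1}) l (𝓝 1)) ∧
    (Tendsto (fun i => cyclomaticNumber (G i)) l atTop →
      β =o[l] (fun i => (cyclomaticNumber (G i) : ℝ)) →
      Tendsto (fun i => coupling (G i) (β i) {ω | ω.2 ≠ MST (G i) ω.1}) l (𝓝 1)) := by
  have hprob := hG.mono fun i hGi => isProbabilityMeasure_coupling hGi (β i)
  have hmeas := fun i => measurableSet_eq_MST (G i)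
  refine ⟨fun hβ hm h => ?_, fun hk h => ?_⟩
  · simpa only [Set.compl_ofPred, ne_eq, not_not] using
      tendsto_measure_compl_one hprob (fun i => (hmeas i).compl)
        (tendsto_coupling_ne_MST hG hβ hm h)
  · exact tendsto_measure_compl_one hprob hmeas (tendsto_coupling_eq_MST hG hk h)

theorem mainTheorem4 (β : ℕ → ℝ) (hβ : ∀ n, 0 ≤ β n) :
    ((fun n : ℕ => (n : ℝ) ^ 2 * Real.log n) =o[atTop] β →
      Tendsto (fun n : ℕ =>
          RandomSpanningTree.coupling (⊤ : SimpleGraph (Fin n)) (β n)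
            {ω | ω.2 = RandomSpanningTree.MST ⊤ ω.1})
        atTop (𝓝 1)) ∧
    (β =o[atTop] (fun n : ℕ => (n : ℝ) ^ 2) →
      Tendsto (fun n : ℕ =>
          RandomSpanningTree.coupling (⊤ : SimpleGraph (Fin n)) (β n)
            {ω | ω.2 ≠ RandomSpanningTree.MST ⊤ ω.1})
        atTop (𝓝 1)) := by
  have general := mainTheorem4_general RandomSpanningTree.eventually_connected_top_fin β
  exact ⟨fun h => general.1 (.of_forall hβ) RandomSpanningTree.tendsto_card_edgeSet_top
      (RandomSpanningTree.isBigO_card_edgeSet_top_mul_log.trans_isLittleO h),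
    fun h => general.2 RandomSpanningTree.tendsto_cyclomaticNumber_top
      (h.trans_isBigO RandomSpanningTree.isBigO_sq_cyclomaticNumber_top)⟩
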